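/- **Setting.** Let $\mathbb H=\{(r,\theta): r>0,\ \theta\in\mathbb R\}$. A function $f$ on an open set $\mathcal D\subset\mathbb H$ is *polar-analytic* if for every $(r_0,\theta_0)\in\mathcal D$ the limit $$(D_{\rm pol}f)(r_0,\theta_0)=\lim_{(r,\theta)\to(r_0,\theta_0)}\frac{f(r,\theta)-f(r_0,\theta_0)}{re^{i\theta}-r_0e^{i\theta_0}}\in\mathbb C$$ exists. For $c\in\mathbb R$ write $(re^{i\theta})^c:=r^c e^{ic\theta}$, which is single-valued on $\mathbb H$. For $k\in\mathbb N_0$ let $$(\widetilde\Theta_c^kf)(r,\theta)=\sum_{j=0}^k S_c(k,j)\,r^je^{ij\theta}(D_{\rm pol}^jf)(r,\theta),$$ where the numbers $S_c(k,j)$ are given by $S_c(0,0)=1$, $S_c(k,j)=0$ for $j>k$, $S_c(k,0)=c^k$ and $S_c(k+1,j+1)=S_c(k,j)+(c+j+1)S_c(k,j+1)$; in particular $\widetilde\Theta_c^0f=f$ and $\widetilde\Theta_c^1f=re^{i\theta}D_{\rm pol}f+cf$. **Theorem.** Let $\mathcal D\subset\mathbb H$ be a convex domain and let $f:\mathcal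 D\to\mathbb C$ be polar-analytic on $\mathcal D$. Let $\gamma$ be a closed, piecewise continuously differentiable curve lying in $\mathcal D$ whose trace is the boundary of a convex domain $\operatorname{int}(\gamma)\subset\mathcal D$ and which is positively oriented, that is, it winds exactly once counterclockwise in the $(r,\theta)$-plane around every point of $\operatorname{int}(\gamma)$. Then for all $(r_0,\theta_0)\in\operatorname{int}(\gamma)$, $c\in\mathbb R$ and $k\in\mathbb N_0$ the following integral exists and $$\frac1{2\pi i}\int_\gamma\frac{(re^{i\theta})^{c-1}f(r,\theta)\,e^{i\theta}}{\bigl(\log(r/r_0)+i(\theta-\theta_0)\bigr)^{k+1}}\,(dr+ir\,d\theta)=\bigl(r_0e^{i\theta_0}\bigr)^c\,\frac{(\widetilde\Theta_c^kf)(r_0,\theta_0)}{k!}.$$ -/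

import Mathlib

open Set Filter Topology
open scoped unitInterval

noncomputable section

namespace PolarAnalysis

/-- The half-plane of all pairs `(r, θ)` with `r > 0` and `θ` real. Points of `ℝ × ℝ` are read
as pairs `(r, θ)` throughout. -/
def halfPlane : Set (ℝ × ℝ) := {p | 0 < p.1}

/-- The complex number `r e^{iθ}`. -/
def polarPoint (p : ℝ × ℝ) : ℂ := (p.1 : ℂ) * Complex.exp ((p.2 : ℂ) * Complex.I)

/-- The single-valued power `(r e^{iθ})^c = r^c e^{icθ}` on the half-plane (no branch cut:
`θ` is an arbitrary real number, and is not reduced modulo `2π`). -/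
def polarPow (c : ℝ) (p : ℝ × ℝ) : ℂ :=
  ((p.1 ^ c : ℝ) : ℂ) * Complex.exp (((c * p.2 : ℝ) : ℂ) * Complex.I)

/-- `f` has polar derivative `f'` at `p₀ = (r₀, θ₀)`: the quotient
`(f(r,θ) - f(r₀,θ₀)) / (r e^{iθ} - r₀ e^{iθ₀})` tends to `f'` as `(r,θ) → (r₀,θ₀)`,
`(r,θ) ≠ (r₀,θ₀)`. -/
def HasPolarDerivAt (f : ℝ × ℝ → ℂ) (f' : ℂ) (p₀ : ℝ × ℝ) : Prop :=
  Tendsto (fun p => (f p - f p₀) / (polarPoint p - polarPoint p₀)) (𝓝[≠] p₀) (𝓝 f')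

/-- `f` is polar-analytic on the (open) set `D`: it has a polar derivative at every point of `D`.
Since `D` is open, only the values of `f` on `D` matter. -/
def PolarAnalyticOn (f : ℝ × ℝ → ℂ) (D : Set (ℝ × ℝ)) : Prop :=
  ∀ p ∈ D, ∃ f' : ℂ, HasPolarDerivAt f f' p

/-- The polar derivative `D_pol f` (meaningful where the defining limit exists). -/
def polarDeriv (f : ℝ × ℝ → ℂ) (p₀ : ℝ × ℝ) : ℂ :=
  limUnder (𝓝[≠] p₀) fun p => (f p - f p₀) / (polarPoint p - polarPoint p₀)

/-- The generalized Stirling numbers of the second kind `S_c(k, j)`: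
`S_c(0,0) = 1`, `S_c(k,0) = c^k`, `S_c(k+1,j+1) = S_c(k,j) + (c+j+1) S_c(k,j+1)`,
and `S_c(k,j) = 0` for `j > k`. -/
def mellinStirling (c : ℝ) : ℕ → ℕ → ℝ
  | 0, 0 => 1
  | 0, _ + 1 => 0
  | k + 1, 0 => c * mellinStirling c k 0
  | k + 1, j + 1 => mellinStirling c k j + (c + (j + 1)) * mellinStirling c k (j + 1)

/-- The polar Mellin derivative of order `k`:
`(Θ̃_c^k f)(r,θ) = ∑_{j=0}^k S_c(k,j) r^j e^{ijθ} (D_pol^j f)(r,θ)`. In particular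
`Θ̃_c^0 f = f` and `(Θ̃_c^1 f)(r,θ) = r e^{iθ} (D_pol f)(r,θ) + c f(r,θ)`. -/
def polarMellinDeriv (c : ℝ) (k : ℕ) (f : ℝ × ℝ → ℂ) (p : ℝ × ℝ) : ℂ :=
  ∑ j ∈ Finset.range (k + 1),
    (mellinStirling c k j : ℂ) * polarPoint p ^ j * (polarDeriv^[j] f) p

/-- The complex-valued differential form `F(r,θ) e^{iθ} (dr + i r dθ)`. -/
def polarForm (F : ℝ × ℝ → ℂ) (p : ℝ × ℝ) : ℝ × ℝ →L[ℝ] ℂ :=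
  (F p * Complex.exp ((p.2 : ℂ) * Complex.I)) •
    (Complex.ofRealCLM.comp (ContinuousLinearMap.fst ℝ ℝ ℝ) +
      (Complex.I * (p.1 : ℂ)) • Complex.ofRealCLM.comp (ContinuousLinearMap.snd ℝ ℝ ℝ))

/-- The curve `γ`, parametrized by `[0, 1]`, is piecewise continuously differentiable: it is
continuous, and `[0, 1]` splits into finitely many closed intervals such that `γ` is continuously
differentiable on each of them (with one-sided derivatives at the end points). The derivative is
allowed to vanish, so this covers all piecewise regular curves. -/
def PiecewiseC1 {a b : ℝ × ℝ} (γ : Path a b) : Prop :=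
  ∃ (n : ℕ) (t : ℕ → ℝ), Monotone t ∧ t 0 = 0 ∧ t n = 1 ∧
    ∀ i < n, ContDiffOn ℝ 1 γ.extend (Icc (t i) (t (i + 1)))

/-- The closed curve `γ` winds exactly once, in the counterclockwise sense, around the point `q`
of the plane: in polar coordinates around `q` it is `γ(t) = q + ρ(t) (cos φ(t), sin φ(t))` with
`ρ(t) > 0` and a continuous angle `φ` whose total increment is `2π`. -/
def WindsOnceAround {a : ℝ × ℝ} (γ : Path a a) (q : ℝ × ℝ) : Prop :=
  ∃ φ : I → ℝ, Continuous φ ∧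
    (∀ t, ∃ ρ : ℝ, 0 < ρ ∧ γ t = q + ρ • ((Real.cos (φ t), Real.sin (φ t)) : ℝ × ℝ)) ∧
    φ 1 - φ 0 = 2 * Real.pi

/-- The closed curve `γ` is the positively oriented boundary of the set `Ω`: its trace is the
boundary of `Ω`, and it winds once counterclockwise around every point of `Ω`. -/
def IsPositivelyOrientedBoundary {a : ℝ × ℝ} (γ : Path a a) (Ω : Set (ℝ × ℝ)) : Prop :=
  range γ = frontier Ω ∧ ∀ q ∈ Ω, WindsOnceAround γ q

end PolarAnalysis

end

open PolarAnalysis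

/-! In the coordinate z = log r + iθ, polar analyticity of f is holomorphy of F(z) = f(e^{Re z}, Im
z), and (re^{iθ})^{c-1} f e^{iθ} (dr + ir dθ) becomes h(z) dz with h = e^{cz} F. Moreover h^{(k)} =
e^{cz} Θ̃_c^k f (`hasDerivAt_exp_mul_polarMellinDeriv`), so the claim is Cauchy's formula for
h^{(k)}(z₀).

Convexity of D and the winding of γ are given in the (r, θ)-plane, and `polarLog` need not preserve
convexity. Hence vanishing of integrals of holomorphic functions comes from closed forms on D itself
(`exists_hasFDerivAt_smul_polarLogDeriv`), and the winding is carried over by monotonicity of log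
(`exists_log_polarLog_sub`). With these two inputs, `integral_div_sub_pow` gives the formula by
removing the singularity for k = 0 and integrating by parts to lower the pole order. -/

namespace PolarAnalysis

/-! ### The coordinate z = log r + iθ -/

/-- The logarithm `log r + iθ` of `r e^{iθ}`. -/
noncomputable def polarLog (p : ℝ × ℝ) : ℂ := (Real.log p.1 : ℂ) + Complex.I * (p.2 : ℂ)

/-- The polar coordinates `(e^x, y)` of `exp (x + iy)`, the inverse of `polarLog`. -/
noncomputable def polarExp (z : ℂ) : ℝ × ℝ := (Real.exp z.re, z.im)

theorem isOpen_halfPlane : IsOpen halfPlane := isOpen_lt continuous_const continuous_fst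

theorem polarExp_mem_halfPlane (z : ℂ) : polarExp z ∈ halfPlane := Real.exp_pos _

theorem polarLog_re (p : ℝ × ℝ) : (polarLog p).re = Real.log p.1 := by simp [polarLog]

theorem polarLog_im (p : ℝ × ℝ) : (polarLog p).im = p.2 := by simp [polarLog]

theorem polarExp_polarLog {p : ℝ × ℝ} (hp : p ∈ halfPlane) : polarExp (polarLog p) = p := by
  ext
  · rw [polarExp, polarLog_re, Real.exp_log hp]
  · rw [polarExp, polarLog_im]

theorem polarLog_polarExp (z : ℂ) : polarLog (polarExp z) = z := by
  apply Complex.ext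
  · rw [polarLog_re, polarExp, Real.log_exp]
  · rw [polarLog_im, polarExp]

theorem polarPoint_eq_exp {p : ℝ × ℝ} (hp : p ∈ halfPlane) :
    polarPoint p = Complex.exp (polarLog p) := by
  rw [polarPoint, polarLog, Complex.exp_add, ← Complex.ofReal_exp, Real.exp_log hp, mul_comm Complex.I]

theorem polarPoint_polarExp (z : ℂ) : polarPoint (polarExp z) = Complex.exp z := by
  rw [polarPoint_eq_exp (polarExp_mem_halfPlane z), polarLog_polarExp]

theorem polarPow_eq_exp (c : ℝ) {p : ℝ × ℝ} (hp : p ∈ halfPlane) :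
    polarPow c p = Complex.exp (c * polarLog p) := by
  rw [polarPow, polarLog, mul_add, Complex.exp_add, ← Complex.ofReal_mul, ← Complex.ofReal_exp,
    Real.rpow_def_of_pos hp, mul_comm (Real.log p.1)]
  congr 2
  push_cast
  ring

theorem continuous_polarExp : Continuous polarExp := by
  unfold polarExp
  fun_prop

theorem continuousOn_polarLog : ContinuousOn polarLog halfPlane := by
  unfold polarLog
  have h : ContinuousOn (fun p : ℝ × ℝ => Real.log p.1) halfPlane :=
    continuous_fst.continuousOn.log fun p hp => (show 0 < p.1 from hp).ne'
  exact (Complex.continuous_ofReal.comp_continuousOn h).add (by fun_prop)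

theorem injective_polarExp : Function.Injective polarExp :=
  Function.LeftInverse.injective polarLog_polarExp

theorem tendsto_polarExp_nhdsNE (z : ℂ) :
    Tendsto polarExp (𝓝[≠] z) (𝓝[≠] polarExp z) :=
  tendsto_nhdsWithin_of_tendsto_nhds_of_eventually_within _
    (continuous_polarExp.continuousAt.mono_left nhdsWithin_le_nhds)
    (eventually_nhdsWithin_of_forall fun _ hw => injective_polarExp.ne hw)

theorem tendsto_polarLog_nhdsNE (z : ℂ) :
    Tendsto polarLog (𝓝[≠] polarExp z) (𝓝[≠] z) := by
  have hmem : halfPlane ∈ 𝓝 (polarExp z) := isOpen_halfPlane.mem_nhds (polarExp_mem_halfPlane z)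
  have hc : Tendsto polarLog (𝓝 (polarExp z)) (𝓝 z) := by
    simpa only [ContinuousAt, polarLog_polarExp] using continuousOn_polarLog.continuousAt hmem
  refine tendsto_nhdsWithin_of_tendsto_nhds_of_eventually_within _ (hc.mono_left nhdsWithin_le_nhds) ?_
  filter_upwards [self_mem_nhdsWithin, mem_nhdsWithin_of_mem_nhds hmem] with p hp hpH hz
  exact hp (by rw [← polarExp_polarLog hpH, hz]; rfl)

/-! ### Polar derivatives as complex derivatives -/

/-- In the coordinate `z = log r + iθ`, polar differentiability is complex differentiability. -/
theorem hasPolarDerivAt_polarExp_iff {f : ℝ × ℝ → ℂ} {f' z : ℂ} :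
    HasPolarDerivAt f f' (polarExp z) ↔
      HasDerivAt (fun w => f (polarExp w)) (Complex.exp z * f') z := by
  have hexp : Tendsto (slope Complex.exp z) (𝓝[≠] z) (𝓝 (Complex.exp z)) :=
    hasDerivAt_iff_tendsto_slope.1 (Complex.hasDerivAt_exp z)
  -- `Complex.exp` is not injective, but its derivative never vanishes, so the denominators of the
  -- polar quotient are nonzero near z.
  have hne : ∀ᶠ w in 𝓝[≠] z, Complex.exp w ≠ Complex.exp z :=
    (Complex.hasDerivAt_exp z).eventually_ne (Complex.exp_ne_zero z)
  rw [hasDerivAt_iff_tendsto_slope]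
  constructor
  · intro h
    refine (hexp.mul (h.comp (tendsto_polarExp_nhdsNE z))).congr' ?_
    filter_upwards [hne, self_mem_nhdsWithin] with w hw hwz
    have h1 : Complex.exp w - Complex.exp z ≠ 0 := sub_ne_zero.2 hw
    have h2 : w - z ≠ 0 := sub_ne_zero.2 hwz
    simp only [Function.comp_apply, slope_def_field, polarPoint_polarExp]
    field_simp
  · intro h
    have h3 := (h.div hexp (Complex.exp_ne_zero z)).comp (tendsto_polarLog_nhdsNE z)
    rw [mul_div_cancel_left₀ _ (Complex.exp_ne_zero z)] at h3
    refine h3.congr' ?_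
    filter_upwards [(tendsto_polarLog_nhdsNE z).eventually hne,
      (tendsto_polarLog_nhdsNE z).eventually self_mem_nhdsWithin,
      mem_nhdsWithin_of_mem_nhds (isOpen_halfPlane.mem_nhds (polarExp_mem_halfPlane z))]
      with p hp hpz hpH
    have h1 : Complex.exp (polarLog p) - Complex.exp z ≠ 0 := sub_ne_zero.2 hp
    have h2 : polarLog p - z ≠ 0 := sub_ne_zero.2 hpz
    simp only [Function.comp_apply, Pi.div_apply, slope_def_field, polarPoint_polarExp,
      polarPoint_eq_exp hpH, polarExp_polarLog hpH]
    field_simp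

theorem HasPolarDerivAt.polarDeriv_eq {f : ℝ × ℝ → ℂ} {f' : ℂ} {p : ℝ × ℝ}
    (h : HasPolarDerivAt f f' p) : polarDeriv f p = f' :=
  Tendsto.limUnder_eq h

theorem PolarAnalyticOn.hasDerivAt {f : ℝ × ℝ → ℂ} {D : Set (ℝ × ℝ)} (hf : PolarAnalyticOn f D)
    {z : ℂ} (hz : polarExp z ∈ D) :
    HasDerivAt (fun w => f (polarExp w)) (Complex.exp z * polarDeriv f (polarExp z)) z := by
  obtain ⟨f', h⟩ := hf _ hz
  rw [h.polarDeriv_eq]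
  exact hasPolarDerivAt_polarExp_iff.1 h

/-- With F = f ∘ `polarExp`, the polar derivative reads e^{-z} F'(z), which is holomorphic because F
is. -/
theorem PolarAnalyticOn.polarDeriv {f : ℝ × ℝ → ℂ} {D : Set (ℝ × ℝ)} (hDH : D ⊆ halfPlane)
    (hDo : IsOpen D) (hf : PolarAnalyticOn f D) : PolarAnalyticOn (polarDeriv f) D := by
  have hU : IsOpen (polarExp ⁻¹' D) := hDo.preimage continuous_polarExp
  have hd : DifferentiableOn ℂ (deriv fun w => f (polarExp w)) (polarExp ⁻¹' D) :=
    DifferentiableOn.deriv (fun z hz => (hf.hasDerivAt hz).differentiableAt.differentiableWithinAt) hU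
  intro p hp
  obtain ⟨z, rfl⟩ : ∃ z, polarExp z = p := ⟨_, polarExp_polarLog (hDH hp)⟩
  have hdz : DifferentiableAt ℂ (fun w => PolarAnalysis.polarDeriv f (polarExp w)) z := by
    refine ((Complex.differentiable_exp.comp differentiable_neg).differentiableAt.mul
      (hd.differentiableAt (hU.mem_nhds hp))).congr_of_eventuallyEq ?_
    filter_upwards [hU.mem_nhds hp] with w hw
    simp only [Pi.mul_apply, Function.comp_apply, (hf.hasDerivAt hw).deriv]
    rw [← mul_assoc, ← Complex.exp_add, neg_add_cancel, Complex.exp_zero, one_mul]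
  refine ⟨(Complex.exp z)⁻¹ * deriv (fun w => PolarAnalysis.polarDeriv f (polarExp w)) z,
    hasPolarDerivAt_polarExp_iff.2 ?_⟩
  rw [mul_inv_cancel_left₀ (Complex.exp_ne_zero z)]
  exact hdz.hasDerivAt

theorem PolarAnalyticOn.iterate_polarDeriv {f : ℝ × ℝ → ℂ} {D : Set (ℝ × ℝ)}
    (hDH : D ⊆ halfPlane) (hDo : IsOpen D) (hf : PolarAnalyticOn f D) (j : ℕ) :
    PolarAnalyticOn (PolarAnalysis.polarDeriv^[j] f) D := by
  induction j with
  | zero => exact hf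
  | succ j ih =>
    rw [Function.iterate_succ_apply']
    exact ih.polarDeriv hDH hDo

/-! ### Stirling numbers and polar Mellin derivatives -/

theorem mellinStirling_eq_zero (c : ℝ) {k j : ℕ} (h : k < j) : mellinStirling c k j = 0 := by
  induction k generalizing j with
  | zero =>
    obtain ⟨j, rfl⟩ := Nat.exists_eq_succ_of_ne_zero h.ne'
    rfl
  | succ k ih =>
    obtain ⟨j, rfl⟩ := Nat.exists_eq_succ_of_ne_zero (Nat.ne_zero_of_lt h)
    rw [Nat.succ_eq_add_one, mellinStirling, ih (by omega), ih (by omega)]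
    ring

/-- In the coordinate `z = log r + iθ`, the polar Mellin derivatives of `f` are, up to the factor
`exp (c z)`, the iterated derivatives of `exp (c z) f`. -/
theorem PolarAnalyticOn.hasDerivAt_exp_mul_polarMellinDeriv {f : ℝ × ℝ → ℂ} {D : Set (ℝ × ℝ)}
    (hDH : D ⊆ halfPlane) (hDo : IsOpen D) (hf : PolarAnalyticOn f D) (c : ℝ) (k : ℕ) {z : ℂ}
    (hz : polarExp z ∈ D) :
    HasDerivAt (fun w => Complex.exp (c * w) * polarMellinDeriv c k f (polarExp w))
      (Complex.exp (c * z) * polarMellinDeriv c (k + 1) f (polarExp z)) z := by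
  have hterm : ∀ j : ℕ, HasDerivAt (fun w => (mellinStirling c k j : ℂ) *
      polarPoint (polarExp w) ^ j * (PolarAnalysis.polarDeriv^[j] f) (polarExp w))
      ((mellinStirling c k j : ℂ) * (j * polarPoint (polarExp z) ^ j *
        (PolarAnalysis.polarDeriv^[j] f) (polarExp z) + polarPoint (polarExp z) ^ (j + 1) *
        (PolarAnalysis.polarDeriv^[j + 1] f) (polarExp z))) z := by
    intro j
    simp only [polarPoint_polarExp, Function.iterate_succ_apply', ← Complex.exp_nat_mul]
    have h1 : HasDerivAt (fun w : ℂ => Complex.exp (j * w)) (Complex.exp (j * z) * (j * 1)) z :=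
      ((hasDerivAt_id z).const_mul (j : ℂ)).cexp
    refine ((h1.const_mul _).mul ((hf.iterate_polarDeriv hDH hDo j).hasDerivAt hz)).congr_deriv ?_
    rw [Nat.cast_add, Nat.cast_one, add_mul (j : ℂ), one_mul, Complex.exp_add]
    ring
  have hc : HasDerivAt (fun w : ℂ => Complex.exp (c * w)) (Complex.exp (c * z) * (c * 1)) z :=
    ((hasDerivAt_id z).const_mul (c : ℂ)).cexp
  have hsum := hc.mul (HasDerivAt.fun_sum (u := Finset.range (k + 1)) fun j _ => hterm j)
  refine hsum.congr_deriv ?_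
  have hrhs : polarMellinDeriv c (k + 1) f (polarExp z) =
      ∑ j ∈ Finset.range (k + 1), ((c + j) * (mellinStirling c k j : ℂ)) *
        polarPoint (polarExp z) ^ j * (PolarAnalysis.polarDeriv^[j] f) (polarExp z) +
      ∑ j ∈ Finset.range (k + 1), (mellinStirling c k j : ℂ) *
        polarPoint (polarExp z) ^ (j + 1) *
          (PolarAnalysis.polarDeriv^[j + 1] f) (polarExp z) := by
    -- The added term j = k + 1 vanishes since S_c(k, k+1) = 0; it matches the index ranges so that
    -- the recurrence applies termwise.
    have hext := Finset.sum_range_succ (fun j : ℕ => ((c + j) * (mellinStirling c k j : ℂ)) *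
      polarPoint (polarExp z) ^ j * (PolarAnalysis.polarDeriv^[j] f) (polarExp z)) (k + 1)
    rw [mellinStirling_eq_zero c (Nat.lt_succ_self k), Complex.ofReal_zero, mul_zero, zero_mul,
      zero_mul, add_zero] at hext
    rw [← hext, polarMellinDeriv, Finset.sum_range_succ', Finset.sum_range_succ' _ (k + 1),
      add_right_comm, ← Finset.sum_add_distrib]
    congr 1
    · refine Finset.sum_congr rfl fun j _ => ?_
      rw [mellinStirling]
      push_cast
      ring
    · rw [mellinStirling]
      push_cast
      ring
  rw [hrhs, mul_add, Finset.mul_sum, Finset.mul_sum, Finset.mul_sum,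
    Finset.mul_sum, ← Finset.sum_add_distrib, ← Finset.sum_add_distrib]
  refine Finset.sum_congr rfl fun j _ => ?_
  ring

/-! ### Primitives of pulled-back holomorphic differentials -/

/-- The real derivative `dr / r + i dθ` of `polarLog`. -/
noncomputable def polarLogDeriv (p : ℝ × ℝ) : ℝ × ℝ →L[ℝ] ℂ :=
  p.1⁻¹ • Complex.ofRealCLM.comp (ContinuousLinearMap.fst ℝ ℝ ℝ) +
    Complex.I • Complex.ofRealCLM.comp (ContinuousLinearMap.snd ℝ ℝ ℝ)

theorem polarLogDeriv_apply (p v : ℝ × ℝ) :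
    polarLogDeriv p v = (p.1 : ℂ)⁻¹ * v.1 + Complex.I * v.2 := by
  simp [polarLogDeriv]

theorem hasFDerivAt_polarLog {p : ℝ × ℝ} (hp : p ∈ halfPlane) :
    HasFDerivAt polarLog (polarLogDeriv p) p := by
  have h1 : HasFDerivAt (fun q : ℝ × ℝ => Real.log q.1)
      (p.1⁻¹ • ContinuousLinearMap.fst ℝ ℝ ℝ) p :=
    (hasFDerivAt_fst (𝕜 := ℝ)).log (show 0 < p.1 from hp).ne'
  have h2 := Complex.ofRealCLM.hasFDerivAt.comp p h1
  have h3 := (Complex.ofRealCLM.hasFDerivAt.comp p (hasFDerivAt_snd (𝕜 := ℝ) (p := p))).const_smul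
    Complex.I
  refine (h2.add h3).congr_fderiv ?_
  rw [polarLogDeriv, ContinuousLinearMap.comp_smul]

/-- The second derivative -dr ⊗ dr / r² is symmetric, as closedness of the pulled-back differentials
requires. -/
theorem hasFDerivAt_polarLogDeriv {p : ℝ × ℝ} (hp : p ∈ halfPlane) :
    HasFDerivAt polarLogDeriv (((-(p.1 ^ 2)⁻¹) • ContinuousLinearMap.fst ℝ ℝ ℝ).smulRight
      (Complex.ofRealCLM.comp (ContinuousLinearMap.fst ℝ ℝ ℝ))) p :=
  (((hasDerivAt_inv (show 0 < p.1 from hp).ne').comp_hasFDerivAt p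
    (hasFDerivAt_fst (𝕜 := ℝ))).smul_const _).add_const _

/-- On a convex open set in the `(r, θ)`-plane, the pull-back of a holomorphic differential under
`polarLog` has a primitive. -/
theorem exists_hasFDerivAt_smul_polarLogDeriv {D : Set (ℝ × ℝ)} (hDH : D ⊆ halfPlane)
    (hDo : IsOpen D) (hDc : Convex ℝ D) {R : ℂ → ℂ}
    (hR : DifferentiableOn ℂ R (polarExp ⁻¹' D)) :
    ∃ G : ℝ × ℝ → ℂ, ∀ p ∈ D, HasFDerivAt G (R (polarLog p) • polarLogDeriv p) p := by
  have hU : IsOpen (polarExp ⁻¹' D) := hDo.preimage continuous_polarExp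
  have hω : ∀ p ∈ D, HasFDerivAt (fun p => R (polarLog p) • polarLogDeriv p)
      (R (polarLog p) • (((-(p.1 ^ 2)⁻¹) • ContinuousLinearMap.fst ℝ ℝ ℝ).smulRight
        (Complex.ofRealCLM.comp (ContinuousLinearMap.fst ℝ ℝ ℝ))) +
      (((fderiv ℂ R (polarLog p)).restrictScalars ℝ).comp (polarLogDeriv p)).smulRight
        (polarLogDeriv p)) p := by
    intro p hp
    have hmem : polarLog p ∈ polarExp ⁻¹' D := by
      rwa [mem_preimage, polarExp_polarLog (hDH hp)]
    exact (((hR.differentiableAt (hU.mem_nhds hmem)).hasFDerivAt.restrictScalars ℝ).comp p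
      (hasFDerivAt_polarLog (hDH hp))).smul (hasFDerivAt_polarLogDeriv (hDH hp))
  refine hDc.exists_forall_hasFDerivAt_of_fderiv_symmetric hDo
    (fun p hp => (hω p hp).differentiableAt.differentiableWithinAt) fun p hp x y => ?_
  -- Complex linearity of R' turns its contribution into R'·dz(x)·dz(y), symmetric in x and y.
  have hlin : ∀ v : ℝ × ℝ, fderiv ℂ R (polarLog p) (polarLogDeriv p v) =
      polarLogDeriv p v * fderiv ℂ R (polarLog p) 1 := fun v => by
    conv_lhs => rw [← mul_one (polarLogDeriv p v), ← smul_eq_mul, map_smul, smul_eq_mul]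
  rw [(hω p hp).fderiv]
  simp only [add_apply, smul_apply,
    ContinuousLinearMap.smulRight_apply, ContinuousLinearMap.comp_apply,
    ContinuousLinearMap.coe_restrictScalars', hlin, ContinuousLinearMap.coe_fst',
    Complex.ofRealCLM_apply, Complex.real_smul, smul_eq_mul, Complex.ofReal_mul]
  ring

/-! ### Cauchy's formula along a curve -/

/-- If `ζ` has the continuous logarithm `ψ`, then `ψ` is differentiable wherever `ζ` is. -/
theorem _root_.HasDerivAt.of_cexp {ζ ψ : ℝ → ℂ} {ζ' : ℂ} {t : ℝ} (hζ : HasDerivAt ζ ζ' t)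
    (hψ : ContinuousAt ψ t) (h : ∀ᶠ s in 𝓝 t, ζ s = Complex.exp (ψ s)) :
    HasDerivAt ψ (ζ' / ζ t) t := by
  have ht : ζ t = Complex.exp (ψ t) := h.self_of_nhds
  have hne : ζ t ≠ 0 := ht ▸ Complex.exp_ne_zero _
  -- Dividing by ζ t moves the base value to 1, away from the cut of the principal logarithm.
  have hlog : HasDerivAt (fun s => ψ t + Complex.log (ζ s / ζ t)) (ζ' / ζ t) t := by
    have h1 : HasDerivAt (fun s => Complex.log (ζ s / ζ t)) (ζ' / ζ t / (ζ t / ζ t)) t :=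
      (hζ.div_const (ζ t)).clog_real (by rw [div_self hne]; exact Complex.one_mem_slitPlane)
    rw [div_self hne, div_one] at h1
    exact h1.const_add _
  refine hlog.congr_of_eventuallyEq ?_
  -- Continuity keeps ψ s - ψ t in the strip |Im| < π, where the principal logarithm inverts exp.
  have him : ContinuousAt (fun s => (ψ s - ψ t).im) t :=
    Complex.continuous_im.continuousAt.comp (hψ.sub continuousAt_const)
  have hsmall : ∀ᶠ s in 𝓝 t, (ψ s - ψ t).im ∈ Ioo (-Real.pi) Real.pi :=
    him.eventually_mem (by
      rw [sub_self, Complex.zero_im]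
      exact Ioo_mem_nhds (neg_lt_zero.2 Real.pi_pos) Real.pi_pos)
  filter_upwards [h, hsmall] with s hs hs'
  rw [hs, ht, ← Complex.exp_sub, Complex.log_exp hs'.1 hs'.2.le]
  ring

/-- Cauchy's formula for the higher derivatives along a closed curve `ζ` in `U`, given that
holomorphic functions on `U` integrate to zero along `ζ` and that `ζ` winds once around `z₀`. -/
theorem integral_div_sub_pow {U : Set ℂ} (hU : IsOpen U) {z₀ : ℂ} (hz₀ : z₀ ∈ U)
    {ζ ζ' : ℝ → ℂ} {s : Set ℝ} (hs : s.Countable) (hζc : ContinuousOn ζ (Icc 0 1))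
    (hζd : ∀ t ∈ Ioo (0 : ℝ) 1 \ s, HasDerivAt ζ (ζ' t) t)
    (hζi : IntervalIntegrable ζ' MeasureTheory.volume 0 1)
    (hζU : ∀ t ∈ Icc (0 : ℝ) 1, ζ t ∈ U) (hζne : ∀ t ∈ Icc (0 : ℝ) 1, ζ t ≠ z₀)
    (hclosed : ζ 0 = ζ 1)
    (hzero : ∀ R : ℂ → ℂ, DifferentiableOn ℂ R U → ∫ t in (0 : ℝ)..1, R (ζ t) * ζ' t = 0)
    (hindex : ∫ t in (0 : ℝ)..1, (ζ t - z₀)⁻¹ * ζ' t = 2 * Real.pi * Complex.I)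
    {h : ℕ → ℂ → ℂ} (hh : ∀ n, ∀ z ∈ U, HasDerivAt (h n) (h (n + 1) z) z) (k n : ℕ) :
    ∫ t in (0 : ℝ)..1, h n (ζ t) / (ζ t - z₀) ^ (k + 1) * ζ' t =
      2 * Real.pi * Complex.I * (h (n + k) z₀ / k.factorial) := by
  have hne : ∀ t ∈ Icc (0 : ℝ) 1, ζ t - z₀ ≠ 0 := fun t ht => sub_ne_zero.2 (hζne t ht)
  have hu : uIcc (0 : ℝ) 1 = Icc 0 1 := uIcc_of_le zero_le_one
  have hdiff : ∀ n, DifferentiableOn ℂ (h n) U := fun n z hz =>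
    (hh n z hz).differentiableAt.differentiableWithinAt
  have hcont : ∀ R : ℂ → ℂ, DifferentiableOn ℂ R U →
      ContinuousOn (fun t => R (ζ t)) (Icc (0 : ℝ) 1) := fun R hR =>
    hR.continuousOn.comp hζc hζU
  have hint : ∀ {K : ℝ → ℂ}, ContinuousOn K (Icc (0 : ℝ) 1) →
      IntervalIntegrable (fun t => K t * ζ' t) MeasureTheory.volume 0 1 := fun hK =>
    hζi.continuousOn_mul (hu ▸ hK)
  have hpow : ∀ m : ℕ, ContinuousOn (fun t => (ζ t - z₀) ^ m) (Icc (0 : ℝ) 1) := fun m =>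
    (hζc.sub continuousOn_const).pow m
  induction k generalizing n with
  | zero =>
    -- Off z₀, h_n(z)/(z - z₀) is the holomorphic divided difference plus h_n(z₀)/(z - z₀); only the
    -- latter contributes.
    have hR : DifferentiableOn ℂ (dslope (h n) z₀) U :=
      (Complex.differentiableOn_dslope (hU.mem_nhds hz₀)).2 (hdiff n)
    have heq : EqOn (fun t => h n (ζ t) / (ζ t - z₀) ^ (0 + 1) * ζ' t)
        (fun t => dslope (h n) z₀ (ζ t) * ζ' t + h n z₀ * ((ζ t - z₀)⁻¹ * ζ' t))
        (uIcc 0 1) := by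
      intro t ht
      have h1 := hne t (hu ▸ ht)
      simp only [dslope_of_ne _ (hζne t (hu ▸ ht)), slope_def_field]
      field_simp
      ring
    have hinv : IntervalIntegrable (fun t => (ζ t - z₀)⁻¹ * ζ' t) MeasureTheory.volume 0 1 :=
      hint ((hζc.sub continuousOn_const).inv₀ hne)
    rw [intervalIntegral.integral_congr heq, intervalIntegral.integral_add (hint (hcont _ hR))
      (hinv.const_mul _),
      intervalIntegral.integral_const_mul, hzero _ hR, hindex, Nat.factorial_zero]
    simp only [add_zero, Nat.cast_one, div_one, zero_add]
    ring
  | succ k ih =>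
    have hpne : ∀ t ∈ Icc (0 : ℝ) 1, (ζ t - z₀) ^ (k + 1) ≠ 0 := fun t ht => pow_ne_zero _ (hne t ht)
    have hpne' : ∀ t ∈ Icc (0 : ℝ) 1, (ζ t - z₀) ^ (k + 1 + 1) ≠ 0 := fun t ht =>
      pow_ne_zero _ (hne t ht)
    have hI1 : IntervalIntegrable (fun t => h (n + 1) (ζ t) / (ζ t - z₀) ^ (k + 1) * ζ' t)
        MeasureTheory.volume 0 1 := hint ((hcont _ (hdiff (n + 1))).div (hpow (k + 1)) hpne)
    have hI2 : IntervalIntegrable (fun t => ((k : ℂ) + 1) *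
        (h n (ζ t) / (ζ t - z₀) ^ (k + 1 + 1) * ζ' t)) MeasureTheory.volume 0 1 :=
      IntervalIntegrable.const_mul (hint ((hcont _ (hdiff n)).div (hpow (k + 1 + 1)) hpne')) _
    -- The derivative of h_n(ζ)/(ζ - z₀)^{k+1} integrates to zero around the closed curve. This
    -- trades one pole order for one derivative of h, hence the induction over all n.
    have key := MeasureTheory.integral_eq_of_hasDerivAt_off_countable
      (fun t => h n (ζ t) / (ζ t - z₀) ^ (k + 1))
      (fun t => h (n + 1) (ζ t) / (ζ t - z₀) ^ (k + 1) * ζ' t -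
        ((k : ℂ) + 1) * (h n (ζ t) / (ζ t - z₀) ^ (k + 1 + 1) * ζ' t)) hs
      (hu ▸ (hcont _ (hdiff n)).div (hpow (k + 1)) hpne) ?_ (hI1.sub hI2)
    · rw [intervalIntegral.integral_sub hI1 hI2, intervalIntegral.integral_const_mul, ih (n + 1),
        hclosed, sub_self, sub_eq_zero] at key
      have hk : (k : ℂ) + 1 ≠ 0 := Nat.cast_add_one_ne_zero k
      have hf : (k.factorial : ℂ) ≠ 0 := Nat.cast_ne_zero.2 k.factorial_ne_zero
      apply mul_left_cancel₀ hk
      rw [← key, Nat.factorial_succ, show n + (k + 1) = n + 1 + k by ring]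
      push_cast
      field_simp
    · intro t ht
      rw [min_eq_left zero_le_one, max_eq_right zero_le_one] at ht
      have htI : t ∈ Icc (0 : ℝ) 1 := Ioo_subset_Icc_self ht.1
      have h1 := hne t htI
      have hd := hζd t ht
      have hnum := (hh n (ζ t) (hζU t htI)).comp t hd
      refine (hnum.div ((hd.sub_const z₀).pow (k + 1)) (hpne t htI)).congr_deriv ?_
      simp only [Function.comp_apply, Pi.pow_apply, Nat.add_sub_cancel, Nat.cast_add, Nat.cast_one]
      field_simp
      ring

/-! ### Derivatives of piecewise C¹ curves -/

theorem exists_mem_Ico_succ {t : ℕ → ℝ} {u : ℝ} {n : ℕ} (h0 : t 0 ≤ u) (hn : u < t n) :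
    ∃ i < n, u ∈ Ico (t i) (t (i + 1)) := by
  induction n with
  | zero => exact absurd hn h0.not_gt
  | succ n ih =>
    rcases lt_or_ge u (t n) with h | h
    · obtain ⟨i, hi, hu⟩ := ih h
      exact ⟨i, hi.trans n.lt_succ_self, hu⟩
    · exact ⟨n, n.lt_succ_self, h, hn⟩

theorem PiecewiseC1.exists_countable_hasDerivAt {a b : ℝ × ℝ} {γ : Path a b} (hγ : PiecewiseC1 γ) :
    ∃ s : Set ℝ, s.Countable ∧
      ∀ u ∈ Ioo (0 : ℝ) 1 \ s, HasDerivAt γ.extend (derivWithin γ.extend I u) u := by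
  obtain ⟨n, t, -, h0, h1, hd⟩ := hγ
  refine ⟨range t, countable_range t, fun u ⟨hu, hut⟩ => ?_⟩
  obtain ⟨i, hi, hui⟩ := exists_mem_Ico_succ (t := t) (n := n) (h0 ▸ hu.1.le) (h1 ▸ hu.2)
  have hlt : t i < u := lt_of_le_of_ne hui.1 fun h => hut ⟨i, h⟩
  have hda : DifferentiableAt ℝ γ.extend u :=
    ((hd i hi).differentiableOn one_ne_zero).differentiableAt (Icc_mem_nhds hlt hui.2)
  rw [derivWithin_of_mem_nhds (Icc_mem_nhds hu.1 hu.2)]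
  exact hda.hasDerivAt

theorem PiecewiseC1.intervalIntegrable_derivWithin {a b : ℝ × ℝ} {γ : Path a b}
    (hγ : PiecewiseC1 γ) :
    IntervalIntegrable (derivWithin γ.extend I) MeasureTheory.volume 0 1 := by
  obtain ⟨n, t, hm, h0, h1, hd⟩ := hγ
  rw [← h0, ← h1]
  refine IntervalIntegrable.trans_iterate fun i hi => ?_
  rcases (hm i.le_succ).eq_or_lt with h | h
  · rw [Nat.succ_eq_add_one] at h
    rw [h]
  · have hc : ContinuousOn (derivWithin γ.extend (Icc (t i) (t (i + 1)))) (Icc (t i) (t (i + 1))) :=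
      (hd i hi).continuousOn_derivWithin (uniqueDiffOn_Icc h) le_rfl
    -- The derivatives within the piece and within `I` may differ at break points, so they are
    -- compared on the open piece only.
    refine (hc.intervalIntegrable_of_Icc h.le).congr_uIoo ?_
    rw [uIoo_of_le h.le]
    intro u hu
    have hu' : u ∈ Ioo (0 : ℝ) 1 :=
      ⟨(h0 ▸ hm i.zero_le).trans_lt hu.1, hu.2.trans_le (h1 ▸ hm hi)⟩
    rw [derivWithin_of_mem_nhds (Icc_mem_nhds hu.1 hu.2),
      derivWithin_of_mem_nhds (Icc_mem_nhds hu'.1 hu'.2)]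

/-! ### Transfer of the winding number -/

theorem WindsOnceAround.notMem_range {a q : ℝ × ℝ} {γ : Path a a} (h : WindsOnceAround γ q)
    (t : I) : γ t ≠ q := by
  obtain ⟨φ, -, hφ, -⟩ := h
  obtain ⟨ρ, hρ, ht⟩ := hφ t
  intro hq
  rw [hq, left_eq_add, smul_eq_zero, Prod.mk_eq_zero] at ht
  rcases ht with h | ⟨h1, h2⟩
  · exact hρ.ne' h
  · have := Real.sin_sq_add_cos_sq (φ t)
    rw [h1, h2] at this
    norm_num at this

/-- Strict monotonicity of log: passing to log r only rescales the first component of a difference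
by a positive factor. -/
theorem exists_pos_log_sub_log {x y : ℝ} (hx : 0 < x) (hy : 0 < y) :
    ∃ m : ℝ, 0 < m ∧ Real.log x - Real.log y = m * (x - y) := by
  rcases lt_trichotomy x y with h | rfl | h
  · refine ⟨(Real.log x - Real.log y) / (x - y), div_pos_of_neg_of_neg
      (sub_neg.2 (Real.log_lt_log hx h)) (sub_neg.2 h), ?_⟩
    rw [div_mul_cancel₀ _ (sub_neg.2 h).ne]
  · exact ⟨1, one_pos, by ring⟩
  · refine ⟨(Real.log x - Real.log y) / (x - y), div_pos
      (sub_pos.2 (Real.log_lt_log hy h)) (sub_pos.2 h), ?_⟩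
    rw [div_mul_cancel₀ _ (sub_pos.2 h).ne']

/-- A curve winding once around `q` in the `(r, θ)`-plane winds once around `polarLog q` in the
coordinate `log r + iθ`: the direction of the difference to `q` changes by less than a right
angle. -/
theorem WindsOnceAround.exists_log_polarLog_sub {a q : ℝ × ℝ} {γ : Path a a}
    (h : WindsOnceAround γ q) (hγ : ∀ t, γ t ∈ halfPlane) (hq : q ∈ halfPlane) :
    ∃ ψ : I → ℂ, Continuous ψ ∧ (∀ t, polarLog (γ t) - polarLog q = Complex.exp (ψ t)) ∧
      ψ 1 - ψ 0 = 2 * Real.pi * Complex.I := by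
  obtain ⟨φ, hφc, hφ, hφ1⟩ := h
  -- Rotating back by φ leaves w with real part ρ(m cos² φ + sin² φ) > 0, so its principal logarithm
  -- is continuous.
  let w : I → ℂ := fun t => (polarLog (γ t) - polarLog q) * Complex.exp (-(φ t * Complex.I))
  have hwre : ∀ t, 0 < (w t).re := by
    intro t
    obtain ⟨ρ, hρ, ht⟩ := hφ t
    obtain ⟨m, hm, hlog⟩ := exists_pos_log_sub_log (show 0 < (γ t).1 from hγ t)
      (show 0 < q.1 from hq)
    have e1 : (γ t).1 - q.1 = ρ * Real.cos (φ t) := by simp [ht]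
    have e2 : (γ t).2 - q.2 = ρ * Real.sin (φ t) := by simp [ht]
    have hexp : Complex.exp (-(φ t * Complex.I)) =
        (Real.cos (φ t) : ℂ) - (Real.sin (φ t) : ℂ) * Complex.I := by
      rw [← neg_mul, ← Complex.ofReal_neg, Complex.exp_mul_I, ← Complex.ofReal_cos,
        ← Complex.ofReal_sin, Real.cos_neg, Real.sin_neg, Complex.ofReal_neg]
      ring
    have hre : (w t).re = ρ * (m * Real.cos (φ t) ^ 2 + Real.sin (φ t) ^ 2) := by
      simp only [w, hexp, Complex.mul_re, Complex.sub_re, Complex.sub_im, polarLog_re, polarLog_im,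
        hlog, e1, e2, Complex.ofReal_re, Complex.ofReal_im, Complex.mul_im, Complex.I_re,
        Complex.I_im]
      ring
    rw [hre]
    refine mul_pos hρ ?_
    rcases eq_or_ne (Real.cos (φ t)) 0 with h0 | h0
    · have := Real.sin_sq_add_cos_sq (φ t)
      rw [h0] at this ⊢
      nlinarith
    · have := sq_nonneg (Real.sin (φ t))
      positivity
  have hlogc : Continuous fun t => polarLog (γ t) :=
    continuousOn_polarLog.comp_continuous γ.continuous hγ
  have hwc : Continuous w := by
    refine (hlogc.sub continuous_const).mul ?_
    fun_prop
  have hslit : ∀ t, w t ∈ Complex.slitPlane := fun t => Or.inl (hwre t)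
  refine ⟨fun t => φ t * Complex.I + Complex.log (w t), ?_, fun t => ?_, ?_⟩
  · exact Continuous.add (by fun_prop) (hwc.clog hslit)
  · rw [Complex.exp_add, Complex.exp_log (Complex.slitPlane_ne_zero (hslit t)), mul_left_comm,
      ← Complex.exp_add, add_neg_cancel, Complex.exp_zero, mul_one]
  · have hw : w 1 = w 0 := by
      have : (φ 1 : ℂ) = φ 0 + 2 * Real.pi := by
        rw [sub_eq_iff_eq_add'.1 hφ1]
        push_cast
        ring
      simp only [w, γ.source, γ.target, this]
      rw [show -(((φ 0 : ℂ) + 2 * Real.pi) * Complex.I) =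
        -(φ 0 * Complex.I) - 2 * Real.pi * Complex.I by ring, Complex.exp_periodic.sub_eq]
    dsimp only
    rw [hw, add_sub_add_right_eq_sub, ← sub_mul, ← Complex.ofReal_sub, hφ1]
    push_cast
    ring

/-! ### The integrand in the coordinate z, and the theorem -/

/-- The missing power of re^{iθ} is supplied by e^{iθ}(dr + ir dθ) = re^{iθ} dz. -/
theorem polarForm_polarPow_mul_apply (c : ℝ) (F : ℝ × ℝ → ℂ) {p : ℝ × ℝ} (hp : p ∈ halfPlane)
    (v : ℝ × ℝ) :
    polarForm (fun p => polarPow (c - 1) p * F p) p v =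
      Complex.exp (c * polarLog p) * F p * polarLogDeriv p v := by
  have hr : (p.1 : ℂ) ≠ 0 := Complex.ofReal_ne_zero.2 (show 0 < p.1 from hp).ne'
  have hpow : polarPow (c - 1) p * ((p.1 : ℂ) * Complex.exp (p.2 * Complex.I)) =
      Complex.exp (c * polarLog p) := by
    have h := polarPoint_eq_exp hp
    rw [polarPoint] at h
    rw [h, polarPow_eq_exp _ hp, ← Complex.exp_add]
    push_cast
    ring_nf
  rw [← hpow, polarLogDeriv_apply, polarForm]
  simp only [smul_apply, add_apply, ContinuousLinearMap.comp_apply, ContinuousLinearMap.coe_fst',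
    ContinuousLinearMap.coe_snd', Complex.ofRealCLM_apply, smul_eq_mul]
  field_simp

theorem polarLog_sub_polarLog {p q : ℝ × ℝ} (hp : p ∈ halfPlane) (hq : q ∈ halfPlane) :
    (Real.log (p.1 / q.1) : ℂ) + Complex.I * ((p.2 - q.2 : ℝ) : ℂ) = polarLog p - polarLog q := by
  rw [Real.log_div (show 0 < p.1 from hp).ne' (show 0 < q.1 from hq).ne', polarLog, polarLog]
  push_cast
  ring

end PolarAnalysis

theorem theorem3p4
    (D : Set (ℝ × ℝ)) (hDH : D ⊆ halfPlane) (hDo : IsOpen D) (hDc : Convex ℝ D)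
    (f : ℝ × ℝ → ℂ) (hf : PolarAnalyticOn f D)
    (Ω : Set (ℝ × ℝ)) (hΩD : Ω ⊆ D) (hΩo : IsOpen Ω) (hΩc : Convex ℝ Ω)
    (a : ℝ × ℝ) (γ : Path a a) (hγ : PiecewiseC1 γ) (hγD : Set.range γ ⊆ D)
    (hγΩ : IsPositivelyOrientedBoundary γ Ω)
    (p₀ : ℝ × ℝ) (hp₀ : p₀ ∈ Ω) (c : ℝ) (k : ℕ) :
    CurveIntegrable
        (polarForm fun p => polarPow (c - 1) p * f p /
          ((Real.log (p.1 / p₀.1) : ℂ) + Complex.I * ((p.2 - p₀.2 : ℝ) : ℂ)) ^ (k + 1)) γ ∧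
      1 / (2 * (Real.pi : ℂ) * Complex.I) * curveIntegral
        (polarForm fun p => polarPow (c - 1) p * f p /
          ((Real.log (p.1 / p₀.1) : ℂ) + Complex.I * ((p.2 - p₀.2 : ℝ) : ℂ)) ^ (k + 1)) γ
        = polarPow c p₀ * (polarMellinDeriv c k f p₀ / (k.factorial : ℂ)) := by
  have hp₀D : p₀ ∈ D := hΩD hp₀
  have hwind : WindsOnceAround γ p₀ := hγΩ.2 p₀ hp₀
  have hγmem : ∀ t, γ.extend t ∈ D := fun t => hγD (by rw [← γ.extend_range]; exact mem_range_self t)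
  set ζ : ℝ → ℂ := fun t => polarLog (γ.extend t) with hζ
  set ζ' : ℝ → ℂ := fun t => polarLogDeriv (γ.extend t) (derivWithin γ.extend I t) with hζ'
  set z₀ : ℂ := polarLog p₀ with hz₀
  set h : ℕ → ℂ → ℂ := fun n z => Complex.exp (c * z) * polarMellinDeriv c n f (polarExp z) with hh
  have hU : IsOpen (polarExp ⁻¹' D) := hDo.preimage continuous_polarExp
  have hUmem : ∀ {p}, p ∈ D → polarLog p ∈ polarExp ⁻¹' D := fun hp => by
    rwa [mem_preimage, polarExp_polarLog (hDH hp)]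
  have hhd : ∀ n, ∀ z ∈ polarExp ⁻¹' D, HasDerivAt (h n) (h (n + 1) z) z := fun n z hz =>
    hf.hasDerivAt_exp_mul_polarMellinDeriv hDH hDo c n hz
  have hγc : Continuous γ.extend := γ.continuous_extend
  have hζc : Continuous ζ :=
    continuousOn_polarLog.comp_continuous hγc fun t => hDH (hγmem t)
  have hζ'i : IntervalIntegrable ζ' MeasureTheory.volume 0 1 := by
    have hγ' := hγ.intervalIntegrable_derivWithin
    have h1 : IntervalIntegrable (fun t => (derivWithin γ.extend I t).1)
        MeasureTheory.volume 0 1 := ⟨hγ'.1.fst, hγ'.2.fst⟩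
    have h2 : IntervalIntegrable (fun t => (derivWithin γ.extend I t).2)
        MeasureTheory.volume 0 1 := ⟨hγ'.1.snd, hγ'.2.snd⟩
    have hinv : Continuous fun t => ((γ.extend t).1 : ℂ)⁻¹ :=
      (Complex.continuous_ofReal.comp (continuous_fst.comp hγc)).inv₀ fun t =>
        Complex.ofReal_ne_zero.2 (show 0 < (γ.extend t).1 from hDH (hγmem t)).ne'
    simp only [hζ', polarLogDeriv_apply]
    exact (IntervalIntegrable.continuousOn_mul ⟨h1.1.ofReal, h1.2.ofReal⟩ hinv.continuousOn).add
      (IntervalIntegrable.const_mul ⟨h2.1.ofReal, h2.2.ofReal⟩ _)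
  have hζne : ∀ t ∈ Icc (0 : ℝ) 1, ζ t ≠ z₀ := by
    intro t ht heq
    have hcongr := congrArg polarExp heq
    rw [hζ, hz₀, polarExp_polarLog (hDH (hγmem t)), polarExp_polarLog (hDH hp₀D),
      γ.extend_apply ht] at hcongr
    exact hwind.notMem_range _ hcongr
  have hclosed : ζ 0 = ζ 1 := by simp [hζ]
  obtain ⟨s, hs, hsd⟩ := hγ.exists_countable_hasDerivAt
  have hζd : ∀ t ∈ Ioo (0 : ℝ) 1 \ s, HasDerivAt ζ (ζ' t) t := fun t ht =>
    (hasFDerivAt_polarLog (hDH (hγmem t))).comp_hasDerivAt t (hsd t ht)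
  have hzero : ∀ R : ℂ → ℂ, DifferentiableOn ℂ R (polarExp ⁻¹' D) →
      ∫ t in (0 : ℝ)..1, R (ζ t) * ζ' t = 0 := by
    intro R hR
    obtain ⟨G, hG⟩ := exists_hasFDerivAt_smul_polarLogDeriv hDH hDo hDc hR
    have hGc : ContinuousOn G D := fun p hp => (hG p hp).continuousAt.continuousWithinAt
    -- G ∘ γ is an antiderivative off the break points, and γ is closed.
    rw [MeasureTheory.integral_eq_of_hasDerivAt_off_countable (fun t => G (γ.extend t))
      (fun t => R (ζ t) * ζ' t) hs
      (hGc.comp_continuous hγc hγmem).continuousOn ?_ (hζ'i.continuousOn_mul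
        (hR.continuousOn.comp_continuous hζc fun t => hUmem (hγmem t)).continuousOn)]
    · simp
    · intro t ht
      rw [min_eq_left zero_le_one, max_eq_right zero_le_one] at ht
      exact (hG _ (hγmem t)).comp_hasDerivAt t (hsd t ht)
  have hinvc : ContinuousOn (fun t => (ζ t - z₀)⁻¹) (uIcc 0 1) :=
    (hζc.sub continuous_const).continuousOn.inv₀ fun t ht =>
      sub_ne_zero.2 (hζne t (uIcc_of_le (zero_le_one (α := ℝ)) ▸ ht))
  have hindex : ∫ t in (0 : ℝ)..1, (ζ t - z₀)⁻¹ * ζ' t = 2 * Real.pi * Complex.I := by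
    obtain ⟨ψ, hψc, hψ, hψ1⟩ := hwind.exists_log_polarLog_sub
      (fun t => hDH (hγD (mem_range_self t))) (hDH hp₀D)
    have hψe : Continuous (IccExtend zero_le_one ψ) := hψc.Icc_extend'
    -- The continuous logarithm ψ of ζ - z₀ is an antiderivative of ζ'/(ζ - z₀), with increment 2πi.
    rw [MeasureTheory.integral_eq_of_hasDerivAt_off_countable (IccExtend zero_le_one ψ) _ hs
      hψe.continuousOn ?_ (hζ'i.continuousOn_mul hinvc), ← hψ1, IccExtend_right, IccExtend_left]
    · rfl
    · intro t ht
      rw [min_eq_left zero_le_one, max_eq_right zero_le_one] at ht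
      refine (((hζd t ht).sub_const z₀).of_cexp hψe.continuousAt ?_).congr_deriv
        (by rw [div_eq_inv_mul])
      filter_upwards [Icc_mem_nhds ht.1.1 ht.1.2] with u hu
      simp only [IccExtend_of_mem _ _ hu, ← hψ, hζ, γ.extend_apply hu, hz₀]
  have hfun : curveIntegralFun (polarForm fun p => polarPow (c - 1) p * f p /
      ((Real.log (p.1 / p₀.1) : ℂ) + Complex.I * ((p.2 - p₀.2 : ℝ) : ℂ)) ^ (k + 1)) γ =
      fun t => h 0 (ζ t) / (ζ t - z₀) ^ (k + 1) * ζ' t := by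
    funext t
    have hp := hDH (hγmem t)
    simp only [curveIntegralFun_def, mul_div_assoc]
    rw [polarForm_polarPow_mul_apply c _ hp, polarLog_sub_polarLog hp (hDH hp₀D)]
    simp [hh, hζ, hζ', hz₀, polarExp_polarLog hp, polarMellinDeriv, mellinStirling, mul_div_assoc]
  constructor
  · rw [CurveIntegrable, hfun]
    refine hζ'i.continuousOn_mul ?_
    have hhc : ContinuousOn (h 0) (polarExp ⁻¹' D) := fun z hz =>
      (hhd 0 z hz).continuousAt.continuousWithinAt
    simp only [div_eq_mul_inv, ← inv_pow]
    exact (hhc.comp_continuous hζc fun t => hUmem (hγmem t)).continuousOn.mul (hinvc.pow _)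
  · rw [curveIntegral_def, hfun, integral_div_sub_pow hU (hUmem hp₀D) hs hζc.continuousOn hζd hζ'i
      (fun t _ => hUmem (hγmem t)) hζne hclosed hzero hindex hhd, one_div,
      inv_mul_cancel_left₀ Complex.two_pi_I_ne_zero, zero_add, polarPow_eq_exp c (hDH hp₀D)]
    simp only [hh, polarExp_polarLog (hDH hp₀D), mul_div_assoc]
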